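/- Let $P$ be a finite normal logic program over a set of atoms, i.e. a finite set of rules $a\leftarrow b_1,\dots,b_m,\mathsf{not}\,c_1,\dots,\mathsf{not}\,c_n$. Goals are formulas built with $\wedge,\vee$ from $F$, from literals (atoms $\varphi$ or $\neg\varphi$), and from expressions $T(C)$, where the context $C$ is a set of literals. Each literal occurrence $g_n$ in a goal carries its rewrite chain $g_1\prec\dots\prec g_n$, the sequence of literals from the initial literal to it, each generated by rewriting the preceding one. A chain $l_1\prec\dots\prec l_n$ with $n\ge 2$ is an odd loop if $l_1,l_n$ are complementary; if $l_1=l_n$ it is a positive loop when all its literals are atoms, a negative loop when all are negative, and an even loop otherwise. The last literal $g_n$ of a chain is a loop literal if for some $i<n$ the part from $g_i$ to $g_n$ is a loop. The rewrite system $R^0$ consists of the following rules, applicable to any subformula: (i) a non-loop literal $\varphi$ (resp. $\neg\varphi$) is rewritten to $B_1\vee\dots\vee B_n$ (resp. to the negation normal form of $\neg B_1\wedge\dots\wedge\neg B_n$), where $B_1,\dots,B_n$ are the bodies of the rules with head $\varphi$, read as conjunctions of literals with $\mathsf{not}$ replaced by $\neg$; here an empty disjunction is $F$, an empty body is $T$,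 and $T$ and $\neg F$ are replaced by $T(C)$, with $C$ the set of literals on the chain of the rewritten literal, and $\neg T$ by $F$; (ii) a loop literal $g_n$ is rewritten to $F$ if some $g_i\prec\dots\prec g_n$ with $i<n$ is a positive or an odd loop, and to $T(\{g_1,\dots,g_n\})$ if one is a negative or an even loop; (iii) $F\vee\Phi\to\Phi$, $\Phi\vee F\to\Phi$, $F\wedge\Phi\to F$, $\Phi\wedge F\to F$; $T(C_1)\wedge T(C_2)\to T(C_1\cup C_2)$ if $C_1\cup C_2$ contains no complementary literals, and $\to F$ otherwise; $\Phi_1\wedge(\Phi_2\vee\Phi_3)\to(\Phi_1\wedge\Phi_2)\vee(\Phi_1\wedge\Phi_3)$ and $(\Phi_1\vee\Phi_2)\wedge\Phi_3\to(\Phi_1\wedge\Phi_3)\vee(\Phi_2\wedge\Phi_3)$. For a rewrite system $R$, a literal $g$ and a goal $E$, write $g\to_R E$ if there is a rewrite sequence of zero or more steps from the initial goal $g$ to $E$. A goal is a normal form if it cannot be rewritten further. A computed rule for a literal $p$ on $R$ is a rule $p\to E$ where $p\to_R E$ and $E$ is a normal form, so $E$ is $F$ or $T(D_1)\vee\dots\vee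 T(D_k)$. For each $i\ge 0$, $R^{i+1}$ is obtained from $R^i$ by choosing any set of literals and replacing the rewrite rule of each chosen literal by a computed rule for it on $R^i$. A computed rule is applied to a non-loop literal $g_n$ with chain $g_1\prec\dots\prec g_n$ as follows: with $G=\{g_1,\dots,g_n\}$, $g_n$ is rewritten to the disjunction of the $T(G\cup D_j)$ over those $j$ for which $G\cup D_j$ contains no complementary literals (so to $F$ if the computed rule is $g_n\to F$). Let $i\ge 0$, and suppose that every computed rule in $R^i$ is of the form $p\to F$. Then for every literal $g$ and every normal form $E$, $$g\to_{R^0}E\quad\text{if and only if}\quad g\to_{R^i}E .$$ -/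

import Mathlib

namespace Recycling

/-- A literal: an atom `φ` or its negation `¬ φ`. -/
inductive Literal (α : Type*) where
  | pos (a : α) : Literal α
  | neg (a : α) : Literal α

namespace Literal

variable {α : Type*}

/-- The complementary literal. -/
def compl : Literal α → Literal α
  | pos a => neg a
  | neg a => pos a

/-- The literal is an atom. -/
def IsAtom : Literal α → Prop
  | pos _ => True
  | neg _ => False

end Literal

/-- A rule `head ← pos₁, …, posₘ, not neg₁, …, not negₙ`. -/
structure Rule (α : Type*) where
  head : α
  pos : List α
  neg : List α

/-- The body of a rule, with default negations replaced by negative literals. -/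
def Rule.body {α : Type*} (r : Rule α) : List (Literal α) :=
  r.pos.map Literal.pos ++ r.neg.map Literal.neg

/-- A (finite, normal) program. The order of the list only fixes the order in which the disjuncts
of a completed definition are written. -/
abbrev Program (α : Type*) := List (Rule α)

/-- A context is a set of literals. -/
abbrev Context (α : Type*) := Set (Literal α)

/-- A set of literals is consistent if it contains no complementary pair. -/
def Consistent {α : Type*} (C : Context α) : Prop :=
  ∀ l ∈ C, l.compl ∉ C

/-- The set of literals on a rewrite chain. -/
def chainSet {α : Type*} (S : List (Literal α)) : Context α := {l | l ∈ S}

/-- Goal formulas, with negation only in front of atoms. `lit S l` is an occurrence of the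
literal `l` whose rewrite chain is `S₁ ≺ … ≺ Sₖ ≺ l`; the proper ancestors `S = [S₁, …, Sₖ]`,
oldest first, are recorded because the steps that terminate a chain depend on them.
A literal of an initial goal has `S = []`. -/
inductive Goal (α : Type*) where
  | fls : Goal α
  | tru (C : Context α) : Goal α
  | lit (S : List (Literal α)) (l : Literal α) : Goal α
  | and (Φ Ψ : Goal α) : Goal α
  | or (Φ Ψ : Goal α) : Goal α

namespace Goal

variable {α : Type*}

/-- `Φ₁ ∨ … ∨ Φₙ`, which is `F` if `n = 0`. -/
def disj : List (Goal α) → Goal α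
  | [] => fls
  | [Φ] => Φ
  | Φ :: Ψ :: L => or Φ (disj (Ψ :: L))

/-- `Φ₁ ∧ … ∧ Φₙ`, which is `T(C)` if `n = 0`. -/
def conj (C : Context α) : List (Goal α) → Goal α
  | [] => tru C
  | [Φ] => Φ
  | Φ :: Ψ :: L => and Φ (conj C (Ψ :: L))

/-- The contexts `C₁, …, Cₙ` of the disjunction `T(C₁) ∨ … ∨ T(Cₙ)`; none for `F`. -/
def contexts : Goal α → List (Context α)
  | tru C => [C]
  | or Φ Ψ => Φ.contexts ++ Ψ.contexts
  | _ => []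

end Goal

section Completion

variable {α : Type*}

open Classical in
/-- The bodies of the rules of `P` with head `a`, in the order of `P`. -/
noncomputable def bodies (P : Program α) (a : α) : List (List (Literal α)) :=
  (P.filter fun r => decide (r.head = a)).map Rule.body

/-- The derived goal of literal rewriting by the completed definition
`a ↔ B₁ ∨ … ∨ Bₙ`: the atom `a` becomes `B₁ ∨ … ∨ Bₙ` and `¬ a` becomes `¬ B₁ ∧ … ∧ ¬ Bₙ` in
negation normal form. `S` holds the proper ancestors of the rewritten literal. An empty body is
`T`, an atom without rules is `F`; `T` and `¬ F` become `T(C)` with `C` the literals on the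
chain, and `¬ T` becomes `F`. -/
noncomputable def derivedGoal (P : Program α) (S : List (Literal α)) : Literal α → Goal α
  | .pos a =>
    Goal.disj <| (bodies P a).map fun B =>
      Goal.conj (chainSet (S ++ [.pos a])) (B.map fun b => Goal.lit (S ++ [.pos a]) b)
  | .neg a =>
    Goal.conj (chainSet (S ++ [.neg a])) <| (bodies P a).map fun B =>
      Goal.disj (B.map fun b => Goal.lit (S ++ [.neg a]) b.compl)

end Completion

section Loops

variable {α : Type*}

/-- The chain begins and ends with complementary literals. -/
def IsOddLoop (S : List (Literal α)) : Prop :=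
  ∃ (l : Literal α) (M : List (Literal α)), S = l :: M ++ [l.compl]

/-- The chain has at least two entries, and begins and ends with the same literal. -/
def SameEnds (S : List (Literal α)) : Prop :=
  ∃ (l : Literal α) (M : List (Literal α)), S = l :: M ++ [l]

def IsPositiveLoop (S : List (Literal α)) : Prop :=
  SameEnds S ∧ ∀ l ∈ S, l.IsAtom

def IsNegativeLoop (S : List (Literal α)) : Prop :=
  SameEnds S ∧ ∀ l ∈ S, ¬ l.IsAtom

def IsEvenLoop (S : List (Literal α)) : Prop :=
  SameEnds S ∧ ¬ IsPositiveLoop S ∧ ¬ IsNegativeLoop S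

/-- The last literal of the rewrite chain `S = g₁ ≺ … ≺ gₙ` ends a positive loop or an odd loop
`gᵢ ≺⁺ gₙ`. -/
def FailingLoop (S : List (Literal α)) : Prop :=
  ∃ S', S' <:+ S ∧ (IsPositiveLoop S' ∨ IsOddLoop S')

/-- The last literal of the rewrite chain `S = g₁ ≺ … ≺ gₙ` ends a negative loop or an even loop
`gᵢ ≺⁺ gₙ`. -/
def SucceedingLoop (S : List (Literal α)) : Prop :=
  ∃ S', S' <:+ S ∧ (IsNegativeLoop S' ∨ IsEvenLoop S')

/-- The last literal of the rewrite chain is a loop literal. -/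
def EndsInLoop (S : List (Literal α)) : Prop :=
  FailingLoop S ∨ SucceedingLoop S

end Loops

section Rewriting

variable {α : Type*}

/-- The computed rules `p → E` of a rewrite system: `R p = some E` if the rule for `p` has been
replaced by `p → E`, and `R p = none` if `p` keeps its rule from the completion of the program. -/
abbrev ComputedRules (α : Type*) := Literal α → Option (Goal α)

open Classical in
/-- The right-hand side of the recycling rule for a literal with rewrite chain
`S = g₁ ≺ … ≺ gₙ` and computed rule `gₙ → E`: with `G` the set of literals on `S`, the
disjunction of the `T(G ∪ D)` for those `T(D)` in `E` with `D ∪ G` consistent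
(in particular `F` if `E` is `F`). -/
noncomputable def recycled (S : List (Literal α)) (E : Goal α) : Goal α :=
  Goal.disj <| (E.contexts.filter fun D => decide (Consistent (D ∪ chainSet S))).map fun D =>
    Goal.tru (chainSet S ∪ D)

/-- One rewrite step in the rewrite system of the program `P` with computed rules `R`. -/
inductive Step (P : Program α) (R : ComputedRules α) : Goal α → Goal α → Prop
  /-- Literal rewriting at a non-loop literal, by the completion. -/
  | program {S l} : ¬ EndsInLoop (S ++ [l]) → R l = none →
      Step P R (.lit S l) (derivedGoal P S l)
  /-- Literal rewriting at a non-loop literal, by the recycling rule. -/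
  | recycle {S l E} : ¬ EndsInLoop (S ++ [l]) → R l = some E →
      Step P R (.lit S l) (recycled (S ++ [l]) E)
  | lr1 {S l} : FailingLoop (S ++ [l]) → Step P R (.lit S l) .fls
  | lr2 {S l} : SucceedingLoop (S ++ [l]) → Step P R (.lit S l) (.tru (chainSet (S ++ [l])))
  | sr1 {Φ} : Step P R (.or .fls Φ) Φ
  | sr1' {Φ} : Step P R (.or Φ .fls) Φ
  | sr2 {Φ} : Step P R (.and .fls Φ) .fls
  | sr2' {Φ} : Step P R (.and Φ .fls) .fls
  | sr3 {C₁ C₂} : Consistent (C₁ ∪ C₂) →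
      Step P R (.and (.tru C₁) (.tru C₂)) (.tru (C₁ ∪ C₂))
  | sr4 {C₁ C₂} : ¬ Consistent (C₁ ∪ C₂) → Step P R (.and (.tru C₁) (.tru C₂)) .fls
  | sr5 {Φ₁ Φ₂ Φ₃} : Step P R (.and Φ₁ (.or Φ₂ Φ₃)) (.or (.and Φ₁ Φ₂) (.and Φ₁ Φ₃))
  | sr5' {Φ₁ Φ₂ Φ₃} : Step P R (.and (.or Φ₁ Φ₂) Φ₃) (.or (.and Φ₁ Φ₃) (.and Φ₂ Φ₃))
  | andLeft {Φ Φ' Ψ} : Step P R Φ Φ' → Step P R (.and Φ Ψ) (.and Φ' Ψ)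
  | andRight {Φ Ψ Ψ'} : Step P R Ψ Ψ' → Step P R (.and Φ Ψ) (.and Φ Ψ')
  | orLeft {Φ Φ' Ψ} : Step P R Φ Φ' → Step P R (.or Φ Ψ) (.or Φ' Ψ)
  | orRight {Φ Ψ Ψ'} : Step P R Ψ Ψ' → Step P R (.or Φ Ψ) (.or Φ Ψ')

/-- `g →_R E`: there is a rewrite sequence (of zero or more steps) from the literal `g`, as an
initial goal, to the goal `E`. -/
def RewritesTo (P : Program α) (R : ComputedRules α) (g : Literal α) (E : Goal α) : Prop :=
  Relation.ReflTransGen (Step P R) (.lit [] g) E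

/-- `E` cannot be rewritten any further. -/
def IsNormalForm (P : Program α) (R : ComputedRules α) (E : Goal α) : Prop :=
  ∀ E', ¬ Step P R E E'

/-- `p → E` is a computed rule for `p` on the rewrite system with computed rules `R`. -/
def IsComputedRule (P : Program α) (R : ComputedRules α) (p : Literal α) (E : Goal α) : Prop :=
  RewritesTo P R p E ∧ IsNormalForm P R E

/-- The original rewrite system `R⁰`, without computed rules. -/
def noComputedRules : ComputedRules α := fun _ => none

/-- The system obtained from `R` by replacing the rules of the literals in the domain of `Δ` by
those in `Δ`. -/
def replaceRules (R Δ : ComputedRules α) : ComputedRules α := fun p => (Δ p).or (R p)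

/-- `IsRecyclingSystem P i R`: `R` is a possible `i`-th system `Rⁱ` in a series in which `R⁰` is
the original system and each `Rʲ⁺¹` arises from `Rʲ` by adopting computed rules generated on `Rʲ`
for an arbitrary set of literals. -/
inductive IsRecyclingSystem (P : Program α) : ℕ → ComputedRules α → Prop
  | zero : IsRecyclingSystem P 0 noComputedRules
  | succ {i R} (Δ : ComputedRules α) : IsRecyclingSystem P i R →
      (∀ p E, Δ p = some E → IsComputedRule P R p E) →
      IsRecyclingSystem P (i + 1) (replaceRules R Δ)

end Rewriting

end Recycling

/-!
Let `X` be the set of literals with a computed rule `p → F`. Each `p ∈ X` rewrites to `F` in the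
original system; this follows by induction on the series of systems, since a computed rule other
than `p → F` can never be replaced by `p → F` later (`IsComputedRule.eq_fls`). The recycled step
`p → F` need not be admissible locally: below a chain, `p` may well rewrite to a disjunction of
contexts in the original system. What is true is that no such context survives.

* A context `D` of a normal form of a literal `g` in the original system is the union of the leaves
  of a proof tree of `g`. Such a `D`, being consistent, is a kind of partial stable model: negative
  literals in it are supported, and atoms in it are founded, because a proof tree has no positive
  loops (`RewritesTo.isPartialStable`). Conversely, truth in a partial stable model is invariant
  under rewriting (`TrueIn.step`), so a member of `D` cannot rewrite to `F`. Hence `D` is disjoint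
  from `X` (`RewritesTo.disjoint_failing`).
* From the original system to the system with computed rules: replace in every goal of a rewrite
  sequence the leaves that depend on `X` by `F`, and simplify. Each step becomes a sequence of steps
  of the system with computed rules (`Step.prune`), and the final goal is unchanged, as its contexts
  are disjoint from `X`.
* From the system with computed rules to the original one: where the former rewrites `p` to `F`, the
  latter keeps `p`, and where the former drops `F` from a disjunction, the latter keeps the disjunct
  that stands for it. When the padding gets in the way, it is moved outwards by distribution
  (`Padded.step`). At the end all padding consists of disjuncts at the root. As every goal has a
  normal form (`normalizes`) and the contexts of normal forms of `g` are disjoint from `X`, each of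
  these disjuncts rewrites to `F` and can be dropped (`Padded.steps_of_avoidsContexts`).

Both simulations reproduce the final goal exactly, including the order and the bracketing of its
disjuncts.
-/

namespace Recycling

/-! ### Folds over goals -/

namespace Goal

variable {α : Type*}

/-- Every leaf of the goal satisfies the given conditions: `t` on contexts, `v` on literal
occurrences. -/
def All (t : Context α → Prop) (v : List (Literal α) → Literal α → Prop) : Goal α → Prop
  | fls => True
  | tru C => t C
  | lit S l => v S l
  | and Φ Ψ => Φ.All t v ∧ Ψ.All t v
  | or Φ Ψ => Φ.All t v ∧ Ψ.All t v

/-- The truth value of a goal under a valuation of its leaves: `t` on contexts, `v` on literal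
occurrences. -/
def Eval (t : Context α → Prop) (v : List (Literal α) → Literal α → Prop) : Goal α → Prop
  | fls => False
  | tru C => t C
  | lit S l => v S l
  | and Φ Ψ => Φ.Eval t v ∧ Ψ.Eval t v
  | or Φ Ψ => Φ.Eval t v ∨ Ψ.Eval t v

/-- The goal is a disjunction `T(C₁) ∨ … ∨ T(Cₙ)` with `n ≥ 1`, bracketed in any way. -/
def IsDisj : Goal α → Prop
  | tru _ => True
  | or Φ Ψ => Φ.IsDisj ∧ Ψ.IsDisj
  | _ => False

/-- The goal is `F` or a disjunction of goals `T(C)`: the syntactic form of normal forms. -/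
def IsAnswer (Φ : Goal α) : Prop := Φ = fls ∨ Φ.IsDisj

variable {t : Context α → Prop} {v : List (Literal α) → Literal α → Prop}

theorem all_disj : ∀ {L : List (Goal α)}, (∀ Φ ∈ L, Φ.All t v) → (disj L).All t v
  | [], _ => trivial
  | [Φ], h => h Φ (by simp)
  | Φ :: Ψ :: L, h => ⟨h Φ (by simp), all_disj fun X hX => h X (List.mem_cons_of_mem _ hX)⟩

theorem all_conj {C : Context α} (hC : t C) :
    ∀ {L : List (Goal α)}, (∀ Φ ∈ L, Φ.All t v) → (conj C L).All t v
  | [], _ => hC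
  | [Φ], h => h Φ (by simp)
  | Φ :: Ψ :: L, h => ⟨h Φ (by simp), all_conj hC fun X hX => h X (List.mem_cons_of_mem _ hX)⟩

theorem eval_disj : ∀ {L : List (Goal α)}, (disj L).Eval t v ↔ ∃ Φ ∈ L, Φ.Eval t v
  | [] => by simp [disj, Eval]
  | [Φ] => by simp [disj]
  | Φ :: Ψ :: L => by
    rw [disj, Eval, eval_disj, List.exists_mem_cons_iff (a := Φ)]

theorem eval_conj {C : Context α} (hC : t C) :
    ∀ {L : List (Goal α)}, (conj C L).Eval t v ↔ ∀ Φ ∈ L, Φ.Eval t v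
  | [] => by simpa [conj, Eval] using hC
  | [Φ] => by simp [conj]
  | Φ :: Ψ :: L => by
    rw [conj, Eval, eval_conj hC, List.forall_mem_cons (a := Φ)]

theorem IsDisj.contexts_ne_nil : ∀ {Φ : Goal α}, Φ.IsDisj → Φ.contexts ≠ []
  | tru _, _ => by simp [contexts]
  | or _ _, h => by simp [contexts, h.1.contexts_ne_nil]
  | fls, h | lit _ _, h | and _ _, h => h.elim

theorem All.of_mem_contexts :
    ∀ {Φ : Goal α}, Φ.All t v → ∀ {C}, C ∈ Φ.contexts → t C
  | tru C, h, _, hC => by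
    rw [contexts, List.mem_singleton] at hC
    exact hC ▸ h
  | or _ _, h, _, hC => by
    rw [contexts, List.mem_append] at hC
    exact hC.elim h.1.of_mem_contexts h.2.of_mem_contexts
  | fls, _, _, hC | lit _ _, _, _, hC | and _ _, _, _, hC => by simp [contexts] at hC

theorem isDisj_disj_tru {β : Type*} (f : β → Context α) :
    ∀ {L : List β}, L ≠ [] → (disj (L.map fun b => tru (f b))).IsDisj
  | [], h => (h rfl).elim
  | [_], _ => trivial
  | _ :: b :: L, _ => ⟨trivial, isDisj_disj_tru f (L := b :: L) (by simp)⟩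

end Goal

variable {α : Type*} {P : Program α} {R : ComputedRules α}

theorem all_derivedGoal {t : Context α → Prop} {v : List (Literal α) → Literal α → Prop}
    {S : List (Literal α)} {l : Literal α} (ht : t (chainSet (S ++ [l])))
    (hv : ∀ B ∈ bodies P (match l with | .pos a => a | .neg a => a), ∀ b ∈ B,
      v (S ++ [l]) (match l with | .pos _ => b | .neg _ => b.compl)) :
    (derivedGoal P S l).All t v := by
  cases l with
  | pos a =>
    refine Goal.all_disj fun Φ hΦ => ?_
    obtain ⟨B, hB, rfl⟩ := List.mem_map.1 hΦ
    refine Goal.all_conj ht fun Ψ hΨ => ?_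
    obtain ⟨b, hb, rfl⟩ := List.mem_map.1 hΨ
    exact hv B hB b hb
  | neg a =>
    refine Goal.all_conj ht fun Φ hΦ => ?_
    obtain ⟨B, hB, rfl⟩ := List.mem_map.1 hΦ
    refine Goal.all_disj fun Ψ hΨ => ?_
    obtain ⟨b, hb, rfl⟩ := List.mem_map.1 hΨ
    exact hv B hB b hb

theorem eval_derivedGoal_pos {t : Context α → Prop} {v : List (Literal α) → Literal α → Prop}
    {S : List (Literal α)} {a : α} (ht : t (chainSet (S ++ [.pos a]))) :
    (derivedGoal P S (.pos a)).Eval t v ↔ ∃ B ∈ bodies P a, ∀ b ∈ B, v (S ++ [.pos a]) b := by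
  simp [derivedGoal, Goal.eval_disj, Goal.eval_conj ht, Goal.Eval]

theorem eval_derivedGoal_neg {t : Context α → Prop} {v : List (Literal α) → Literal α → Prop}
    {S : List (Literal α)} {a : α} (ht : t (chainSet (S ++ [.neg a]))) :
    (derivedGoal P S (.neg a)).Eval t v ↔
      ∀ B ∈ bodies P a, ∃ b ∈ B, v (S ++ [.neg a]) b.compl := by
  simp [derivedGoal, Goal.eval_disj, Goal.eval_conj ht, Goal.Eval]

/-! ### Loops -/

theorem Literal.compl_compl (l : Literal α) : l.compl.compl = l := by cases l <;> rfl

theorem Literal.compl_ne (l : Literal α) : l.compl ≠ l := by cases l <;> simp [Literal.compl]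

theorem chainSet_append (S T : List (Literal α)) :
    chainSet (S ++ T) = chainSet S ∪ chainSet T := by
  ext x; simp [chainSet]

theorem mem_chainSet {S : List (Literal α)} {l : Literal α} : l ∈ chainSet S ↔ l ∈ S := Iff.rfl

theorem endsInLoop_of_mem {S : List (Literal α)} {l : Literal α} (h : l ∈ S) :
    EndsInLoop (S ++ [l]) := by
  obtain ⟨A, M, rfl⟩ := List.append_of_mem h
  have hs : (l :: M ++ [l]) <:+ (A ++ l :: M) ++ [l] := ⟨A, by simp⟩
  have he : SameEnds (l :: M ++ [l]) := ⟨l, M, rfl⟩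
  by_cases hp : IsPositiveLoop (l :: M ++ [l])
  · exact .inl ⟨_, hs, .inl hp⟩
  by_cases hn : IsNegativeLoop (l :: M ++ [l])
  · exact .inr ⟨_, hs, .inl hn⟩
  · exact .inr ⟨_, hs, .inr ⟨he, hp, hn⟩⟩

theorem endsInLoop_of_compl_mem {S : List (Literal α)} {l : Literal α} (h : l.compl ∈ S) :
    EndsInLoop (S ++ [l]) := by
  obtain ⟨A, M, rfl⟩ := List.append_of_mem h
  exact .inl ⟨l.compl :: M ++ [l], ⟨A, by simp⟩, .inr ⟨l.compl, M, by rw [l.compl_compl]⟩⟩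

theorem eq_of_suffix_concat {S M : List (Literal α)} {l x y : Literal α}
    (h : (x :: M ++ [y]) <:+ S ++ [l]) : y = l ∧ x ∈ S := by
  obtain ⟨A, hA⟩ := h
  rw [← List.append_assoc] at hA
  obtain ⟨h1, h2⟩ := List.append_inj' hA rfl
  refine ⟨by simpa using h2, ?_⟩
  rw [← h1]
  simp

/-- A chain that ends in a negative or an even loop has a part that starts and ends with its last
literal and is not entirely positive. -/
theorem SucceedingLoop.exists_suffix {S : List (Literal α)} {l : Literal α}
    (h : SucceedingLoop (S ++ [l])) :
    ∃ M, (l :: M ++ [l]) <:+ S ++ [l] ∧ ∃ x ∈ l :: M ++ [l], ¬ x.IsAtom := by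
  obtain ⟨S', hS, h⟩ := h
  have hs : SameEnds S' := h.elim And.left And.left
  obtain ⟨x, M, rfl⟩ := hs
  obtain ⟨rfl, -⟩ := eq_of_suffix_concat hS
  refine ⟨M, hS, ?_⟩
  rcases h with h | h
  · exact ⟨x, by simp, h.2 x (by simp)⟩
  · by_contra hc
    push Not at hc
    exact h.2.1 ⟨h.1, hc⟩

theorem SucceedingLoop.mem {S : List (Literal α)} {l : Literal α}
    (h : SucceedingLoop (S ++ [l])) : l ∈ S := by
  obtain ⟨M, hM, -⟩ := h.exists_suffix
  exact (eq_of_suffix_concat hM).2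

/-! ### Rewrite sequences and normal forms -/

/-- Rewrite sequences of zero or more steps between arbitrary goals. -/
abbrev Steps (P : Program α) (R : ComputedRules α) : Goal α → Goal α → Prop :=
  Relation.ReflTransGen (Step P R)

theorem Steps.or {Φ Φ' Ψ Ψ' : Goal α} (h : Steps P R Φ Φ') (h' : Steps P R Ψ Ψ') :
    Steps P R (.or Φ Ψ) (.or Φ' Ψ') :=
  (h.lift (fun X => Goal.or X Ψ) fun _ _ => Step.orLeft).trans
    (h'.lift (fun X => Goal.or Φ' X) fun _ _ => Step.orRight)

theorem Steps.and {Φ Φ' Ψ Ψ' : Goal α} (h : Steps P R Φ Φ') (h' : Steps P R Ψ Ψ') :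
    Steps P R (.and Φ Ψ) (.and Φ' Ψ') :=
  (h.lift (fun X => Goal.and X Ψ) fun _ _ => Step.andLeft).trans
    (h'.lift (fun X => Goal.and Φ' X) fun _ _ => Step.andRight)

theorem Goal.IsDisj.isNormalForm : ∀ {E : Goal α}, E.IsDisj → IsNormalForm P R E
  | .tru _, _ => nofun
  | .or _ _, h => by
    intro E' hs
    cases hs with
    | sr1 => exact h.1
    | sr1' => exact h.2
    | orLeft hs => exact h.1.isNormalForm _ hs
    | orRight hs => exact h.2.isNormalForm _ hs
  | .fls, h | .lit _ _, h | .and _ _, h => h.elim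

theorem Goal.IsAnswer.isNormalForm {E : Goal α} (h : E.IsAnswer) : IsNormalForm P R E := by
  rcases h with rfl | h
  · exact nofun
  · exact h.isNormalForm

theorem exists_step_lit (S : List (Literal α)) (l : Literal α) :
    ∃ E, Step P R (.lit S l) E := by
  by_cases h : EndsInLoop (S ++ [l])
  · exact h.elim (fun h => ⟨_, .lr1 h⟩) fun h => ⟨_, .lr2 h⟩
  · cases hR : R l with
    | none => exact ⟨_, .program h hR⟩
    | some E => exact ⟨_, .recycle h hR⟩

theorem IsNormalForm.isAnswer : ∀ {E : Goal α}, IsNormalForm P R E → E.IsAnswer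
  | .fls, _ => .inl rfl
  | .tru _, _ => .inr trivial
  | .lit S l, h => ((exists_step_lit S l).elim h).elim
  | .or Φ Ψ, h => by
    have h1 : Φ.IsAnswer := isAnswer fun _ hs => h _ hs.orLeft
    have h2 : Ψ.IsAnswer := isAnswer fun _ hs => h _ hs.orRight
    rcases h1 with rfl | h1
    · exact (h _ .sr1).elim
    rcases h2 with rfl | h2
    · exact (h _ .sr1').elim
    exact .inr ⟨h1, h2⟩
  | .and Φ Ψ, h => by
    have h1 : Φ.IsAnswer := isAnswer fun _ hs => h _ hs.andLeft
    have h2 : Ψ.IsAnswer := isAnswer fun _ hs => h _ hs.andRight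
    rcases h1 with rfl | h1
    · exact (h _ .sr2).elim
    rcases h2 with rfl | h2
    · exact (h _ .sr2').elim
    cases Φ <;> try exact h1.elim
    · cases Ψ <;> try exact h2.elim
      · rename_i C₁ C₂
        by_cases hC : Consistent (C₁ ∪ C₂)
        · exact (h _ (.sr3 hC)).elim
        · exact (h _ (.sr4 hC)).elim
      · exact (h _ .sr5).elim
    · exact (h _ .sr5').elim

theorem Goal.IsAnswer.eq_of_steps {E E' : Goal α} (h : E.IsAnswer) (hs : Steps P R E E') :
    E' = E :=
  (Relation.reflTransGen_iff_eq h.isNormalForm).1 hs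

/-! ### Every goal has a normal form in the original system -/

/-- The goal can be rewritten to a normal form. -/
def Normalizes (P : Program α) (R : ComputedRules α) (Φ : Goal α) : Prop :=
  ∃ E : Goal α, Steps P R Φ E ∧ E.IsAnswer

theorem Normalizes.of_steps {Φ Φ' : Goal α} (h : Steps P R Φ Φ') :
    Normalizes P R Φ' → Normalizes P R Φ
  | ⟨E, hs, hE⟩ => ⟨E, h.trans hs, hE⟩

/-- The disjunction of two normal forms rewrites to a normal form that has the contexts of both. -/
theorem Goal.IsAnswer.or_steps {E E' : Goal α} (h : E.IsAnswer) (h' : E'.IsAnswer) :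
    ∃ E'' : Goal α, Steps P R (.or E E') E'' ∧ E''.IsAnswer ∧
      E''.contexts = E.contexts ++ E'.contexts := by
  rcases h with rfl | h
  · exact ⟨E', .single .sr1, h', rfl⟩
  rcases h' with rfl | h'
  · exact ⟨E, .single .sr1', .inr h, (List.append_nil _).symm⟩
  · exact ⟨_, .refl, .inr ⟨h, h'⟩, rfl⟩

theorem Normalizes.or {Φ Ψ : Goal α} :
    Normalizes P R Φ → Normalizes P R Ψ → Normalizes P R (.or Φ Ψ)
  | ⟨_, hs, hE⟩, ⟨_, hs', hE'⟩ =>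
    let ⟨E'', h, hA, _⟩ := hE.or_steps (P := P) (R := R) hE'
    ⟨E'', (hs.or hs').trans h, hA⟩

theorem Goal.IsDisj.normalizes_and :
    ∀ {E E' : Goal α}, E.IsDisj → E'.IsDisj → Normalizes P R (.and E E')
  | .or _ _, _, h, h' =>
    .of_steps (.single .sr5') ((h.1.normalizes_and h').or (h.2.normalizes_and h'))
  | .tru _, .or _ _, h, h' =>
    .of_steps (.single .sr5)
      ((normalizes_and h h'.1).or (normalizes_and h h'.2))
  | .tru C₁, .tru C₂, _, _ => by
    by_cases hC : Consistent (C₁ ∪ C₂)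
    · exact ⟨_, .single (.sr3 hC), .inr trivial⟩
    · exact ⟨_, .single (.sr4 hC), .inl rfl⟩
  | .tru _, .fls, _, h | .tru _, .lit _ _, _, h | .tru _, .and _ _, _, h => h.elim
  | .fls, _, h, _ | .lit _ _, _, h, _ | .and _ _, _, h, _ => h.elim

theorem Normalizes.and {Φ Ψ : Goal α} :
    Normalizes P R Φ → Normalizes P R Ψ → Normalizes P R (.and Φ Ψ)
  | ⟨_, hs, hE⟩, ⟨_, hs', hE'⟩ => by
    refine .of_steps (hs.and hs') ?_
    rcases hE with rfl | hE
    · exact ⟨_, .single .sr2, .inl rfl⟩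
    rcases hE' with rfl | hE'
    · exact ⟨_, .single .sr2', .inl rfl⟩
    · exact hE.normalizes_and hE'

theorem Goal.All.normalizes : ∀ {Φ : Goal α},
    Φ.All (fun _ => True) (fun S l => Normalizes P R (.lit S l)) → Normalizes P R Φ
  | .fls, _ => ⟨_, .refl, .inl rfl⟩
  | .tru _, _ => ⟨_, .refl, .inr trivial⟩
  | .lit _ _, h => h
  | .and _ _, h => h.1.normalizes.and h.2.normalizes
  | .or _ _, h => h.1.normalizes.or h.2.normalizes

theorem finite_bodyLiterals (P : Program α) :
    {l : Literal α | ∃ r ∈ P, l ∈ r.body ∨ l.compl ∈ r.body}.Finite := by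
  have h : {l : Literal α | ∃ r ∈ P, l ∈ r.body ∨ l.compl ∈ r.body} ⊆
      {l | l ∈ P.flatMap fun r => r.body ++ r.body.map Literal.compl} := by
    rintro l ⟨r, hr, h⟩
    refine List.mem_flatMap.2 ⟨r, hr, List.mem_append.2 (h.imp id fun h => ?_)⟩
    exact List.mem_map.2 ⟨_, h, l.compl_compl⟩
  exact (List.finite_toSet _).subset h

theorem exists_rule_of_mem_bodies {a : α} {B : List (Literal α)} (h : B ∈ bodies P a) :
    ∃ r ∈ P, r.body = B := by
  obtain ⟨r, hr, rfl⟩ := List.mem_map.1 h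
  exact ⟨r, (List.mem_filter.1 hr).1, rfl⟩

/-- Every goal has a normal form in the original system: along a chain without loops no literal
is repeated, and below the first literal all literals come from the finitely many rule bodies. -/
theorem normalizes (P : Program α) (Φ : Goal α) : Normalizes P noComputedRules Φ := by
  set T := {l : Literal α | ∃ r ∈ P, l ∈ r.body ∨ l.compl ∈ r.body} with hT
  have hfin : T.Finite := finite_bodyLiterals P
  -- One expansion suffices to bring all literals into the finite set `T`.
  have expand : ∀ S l, (∀ l' ∈ T, ¬ EndsInLoop (S ++ [l]) →
      Normalizes P noComputedRules (.lit (S ++ [l]) l')) →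
      Normalizes P noComputedRules (.lit S l) := by
    intro S l h
    by_cases hl : EndsInLoop (S ++ [l])
    · rcases hl with hl | hl
      · exact ⟨_, .single (.lr1 hl), .inl rfl⟩
      · exact ⟨_, .single (.lr2 hl), .inr trivial⟩
    refine .of_steps (.single (.program hl rfl)) (Goal.All.normalizes (all_derivedGoal trivial ?_))
    intro B hB b hb
    obtain ⟨r, hr, rfl⟩ := exists_rule_of_mem_bodies hB
    refine h _ ⟨r, hr, ?_⟩ hl
    cases l
    · exact .inl hb
    · exact .inr (by rwa [Literal.compl_compl])
  -- The literals of `T` not yet on the chain decrease with each further expansion.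
  have main : ∀ n S, (T \ chainSet S).ncard ≤ n → ∀ l ∈ T,
      Normalizes P noComputedRules (.lit S l) := by
    intro n
    induction n with
    | zero =>
      intro S hS l hl
      refine expand S l fun l' hl' hnl => (hnl (endsInLoop_of_mem ?_)).elim
      have h0 : T \ chainSet S = ∅ := (Set.ncard_eq_zero hfin.sdiff).1 (Nat.le_zero.1 hS)
      by_contra hc
      exact (h0 ▸ (⟨hl, hc⟩ : l ∈ T \ chainSet S) : l ∈ (∅ : Set (Literal α)))
    | succ n ih =>
      intro S hS l hl
      refine expand S l fun l' hl' hnl => ih _ ?_ l' hl'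
      refine Nat.le_of_lt_succ (lt_of_lt_of_le (Set.ncard_lt_ncard ?_ hfin.sdiff) hS)
      refine ⟨fun x hx => ⟨hx.1, fun h => hx.2 (List.mem_append_left _ h)⟩, fun h => ?_⟩
      have : l ∈ T \ chainSet S := ⟨hl, fun h => hnl (endsInLoop_of_mem h)⟩
      exact (h this).2 (List.mem_append_right _ (List.mem_singleton_self l))
  have all : ∀ Φ : Goal α,
      Φ.All (fun _ => True) (fun S l => Normalizes P noComputedRules (.lit S l)) := by
    intro Φ
    induction Φ with
    | fls => trivial
    | tru C => trivial
    | lit S l => exact expand S l fun l' hl' _ => main _ _ le_rfl l' hl'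
    | and Φ Ψ h1 h2 => exact ⟨h1, h2⟩
    | or Φ Ψ h1 h2 => exact ⟨h1, h2⟩
  exact (all Φ).normalizes

/-! ### Contexts of reachable goals -/

theorem consistent_concat {S : List (Literal α)} {l : Literal α} (hS : Consistent (chainSet S))
    (hl : ¬ EndsInLoop (S ++ [l])) : Consistent (chainSet (S ++ [l])) := by
  have hc : l.compl ∉ S := fun h => hl (endsInLoop_of_compl_mem h)
  intro x hx hx'
  simp only [mem_chainSet, List.mem_append, List.mem_singleton] at hx hx'
  rcases hx with hx | rfl
  · rcases hx' with hx' | hx'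
    · exact hS x hx hx'
    · exact hc (by rwa [← hx', x.compl_compl])
  · exact hx'.elim hc x.compl_ne

/-- The invariant of rewriting from the literal `p`: all contexts and all proper ancestor chains
are consistent, and every context and every chain contains `p`. -/
def Rooted (p : Literal α) : Goal α → Prop :=
  Goal.All (fun C => Consistent C ∧ p ∈ C)
    (fun S l => Consistent (chainSet S) ∧ p ∈ S ++ [l])

theorem Rooted.step {p : Literal α} {Φ Φ' : Goal α} (hs : Step P R Φ Φ') (h : Rooted p Φ) :
    Rooted p Φ' := by
  induction hs with
  | program hl _ =>
    have hc := consistent_concat h.1 hl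
    exact all_derivedGoal ⟨hc, h.2⟩ fun _ _ _ _ => ⟨hc, List.mem_append_left _ h.2⟩
  | recycle hl _ =>
    refine Goal.all_disj fun Ψ hΨ => ?_
    obtain ⟨D, hD, rfl⟩ := List.mem_map.1 hΨ
    have hD' := (List.mem_filter.1 hD).2
    simp only [decide_eq_true_iff] at hD'
    rw [Set.union_comm] at hD'
    exact ⟨hD', .inl h.2⟩
  | lr1 _ => trivial
  | @lr2 S l hl =>
    have : chainSet (S ++ [l]) = chainSet S := by
      ext x
      simp only [mem_chainSet, List.mem_append, List.mem_singleton, or_iff_left_iff_imp]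
      rintro rfl
      exact hl.mem
    exact ⟨this ▸ h.1, h.2⟩
  | sr1 => exact h.2
  | sr1' => exact h.1
  | sr2 => trivial
  | sr2' => trivial
  | sr3 hC => exact ⟨hC, .inl h.1.2⟩
  | sr4 _ => trivial
  | sr5 => exact ⟨⟨h.1, h.2.1⟩, h.1, h.2.2⟩
  | sr5' => exact ⟨⟨h.1.1, h.2⟩, h.1.2, h.2⟩
  | andLeft _ ih => exact ⟨ih h.1, h.2⟩
  | andRight _ ih => exact ⟨h.1, ih h.2⟩
  | orLeft _ ih => exact ⟨ih h.1, h.2⟩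
  | orRight _ ih => exact ⟨h.1, ih h.2⟩

theorem Rooted.of_rewritesTo {p : Literal α} {E : Goal α} (h : RewritesTo P R p E) :
    Rooted p E := by
  induction h with
  | refl =>
    exact ⟨fun _ hx => (List.not_mem_nil hx).elim, by simp⟩
  | tail _ hs ih => exact ih.step hs

/-! ### Proof trees -/

/-- `Proves P Φ C`: the goal `Φ` has a proof tree in the original system, obtained by choosing a
disjunct at each disjunction, and `C` is the union of the contexts at its leaves. Consistency of
`C` is not required. -/
inductive Proves (P : Program α) : Goal α → Context α → Prop
  | tru C : Proves P (.tru C) C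
  | expand {S l C} : ¬ EndsInLoop (S ++ [l]) → Proves P (derivedGoal P S l) C →
      Proves P (.lit S l) C
  | loop {S l} : SucceedingLoop (S ++ [l]) → Proves P (.lit S l) (chainSet (S ++ [l]))
  | and {Φ Ψ C D} : Proves P Φ C → Proves P Ψ D → Proves P (.and Φ Ψ) (C ∪ D)
  | orLeft {Φ Ψ C} : Proves P Φ C → Proves P (.or Φ Ψ) C
  | orRight {Φ Ψ C} : Proves P Ψ C → Proves P (.or Φ Ψ) C

theorem proves_of_mem_contexts : ∀ {Φ : Goal α} {C}, C ∈ Φ.contexts → Proves P Φ C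
  | .tru C, _, h => by
    obtain rfl := List.mem_singleton.1 h
    exact .tru _
  | .or _ _, _, h => by
    rw [Goal.contexts, List.mem_append] at h
    exact h.elim (fun h => .orLeft (proves_of_mem_contexts h))
      fun h => .orRight (proves_of_mem_contexts h)
  | .fls, _, h | .lit _ _, _, h | .and _ _, _, h => by simp [Goal.contexts] at h

/-- Proof trees can be pulled back along rewrite steps of the original system. -/
theorem Proves.of_step {Φ Φ' : Goal α} (hs : Step P noComputedRules Φ Φ') {C : Context α}
    (h : Proves P Φ' C) : Proves P Φ C := by
  induction hs generalizing C with
  | program hl _ => exact .expand hl h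
  | recycle _ hR => cases hR
  | lr1 _ => cases h
  | lr2 hl => cases h; exact .loop hl
  | sr1 => exact .orRight h
  | sr1' => exact .orLeft h
  | sr2 => cases h
  | sr2' => cases h
  | sr3 _ => cases h; exact .and (.tru _) (.tru _)
  | sr4 _ => cases h
  | sr5 =>
    rcases h with _ | _ | _ | _ | h | h <;> cases h
    · exact .and ‹_› (.orLeft ‹_›)
    · exact .and ‹_› (.orRight ‹_›)
  | sr5' =>
    rcases h with _ | _ | _ | _ | h | h <;> cases h
    · exact .and (.orLeft ‹_›) ‹_›
    · exact .and (.orRight ‹_›) ‹_›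
  | andLeft _ ih => cases h; exact .and (ih ‹_›) ‹_›
  | andRight _ ih => cases h; exact .and ‹_› (ih ‹_›)
  | orLeft _ ih =>
    cases h
    · exact .orLeft (ih ‹_›)
    · exact .orRight ‹_›
  | orRight _ ih =>
    cases h
    · exact .orLeft ‹_›
    · exact .orRight (ih ‹_›)

theorem Proves.of_steps {Φ Φ' : Goal α} (hs : Steps P noComputedRules Φ Φ') {C : Context α}
    (h : Proves P Φ' C) : Proves P Φ C := by
  induction hs with
  | refl => exact h
  | tail _ hs ih => exact ih (h.of_step hs)

theorem Proves.subset {Φ : Goal α} {C T : Context α} (h : Proves P Φ C)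
    (hT : Φ.All (fun C' => T ⊆ C') fun S l => T ⊆ chainSet (S ++ [l])) : T ⊆ C := by
  induction h with
  | tru C => exact hT
  | expand _ _ ih =>
    refine ih (all_derivedGoal hT fun _ _ _ _ => ?_)
    rw [chainSet_append]
    exact Set.subset_union_of_subset_left hT _
  | loop _ => exact hT
  | and _ _ ih _ => exact Set.subset_union_of_subset_left (ih hT.1) _
  | orLeft _ ih => exact ih hT.1
  | orRight _ ih => exact ih hT.2

theorem Proves.chainSet_subset {S : List (Literal α)} {l : Literal α} {C : Context α}
    (h : Proves P (.lit S l) C) : chainSet (S ++ [l]) ⊆ C :=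
  h.subset (T := chainSet (S ++ [l])) subset_rfl

theorem Proves.mem {S : List (Literal α)} {l : Literal α} {C : Context α}
    (h : Proves P (.lit S l) C) : l ∈ C :=
  h.chainSet_subset (List.mem_append_right _ (List.mem_singleton_self l))

theorem Proves.eval_mem {Φ : Goal α} {C D : Context α} (h : Proves P Φ C) (hD : C ⊆ D) :
    Φ.Eval (fun _ => True) (fun _ l => l ∈ D) := by
  induction h with
  | tru C => trivial
  | expand hl h _ => exact hD (Proves.expand hl h).mem
  | loop hl => exact hD (Proves.loop (P := P) hl).mem
  | and _ _ ih ih' =>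
    exact ⟨ih (Set.subset_union_left.trans hD), ih' (Set.subset_union_right.trans hD)⟩
  | orLeft _ ih => exact .inl (ih hD)
  | orRight _ ih => exact .inr (ih hD)

/-- All leaves of the goal have the proper ancestor chain `S`, as in the derived goals of the
last literal of `S`. -/
def HasChain (S : List (Literal α)) : Goal α → Prop :=
  Goal.All (fun C => C = chainSet S) (fun S' _ => S' = S)

theorem hasChain_derivedGoal (S : List (Literal α)) (l : Literal α) :
    HasChain (S ++ [l]) (derivedGoal P S l) :=
  all_derivedGoal rfl fun _ _ _ _ => rfl

/-- In a proof tree with labels in `D`, every negative literal below the chain `S` is supported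
by `D`: each body for its atom contains a literal whose complement is in `D`. -/
theorem Proves.support {Φ : Goal α} {C D : Context α} (h : Proves P Φ C) (hD : C ⊆ D)
    {S : List (Literal α)} (hS : HasChain S Φ) {a : α} (ha : .neg a ∈ C) :
    (∀ B ∈ bodies P a, ∃ b ∈ B, b.compl ∈ D) ∨ .neg a ∈ S := by
  induction h generalizing S with
  | tru C =>
    obtain rfl : C = chainSet S := hS
    exact .inr ha
  | @expand S' l C hl h ih =>
    obtain rfl : S' = S := hS
    rcases ih hD (hasChain_derivedGoal S' l) ha with h' | h'
    · exact .inl h'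
    rcases List.mem_append.1 h' with h' | h'
    · exact .inr h'
    obtain rfl := List.mem_singleton.1 h'
    exact .inl ((eval_derivedGoal_neg (t := fun _ => True) trivial).1 (h.eval_mem hD))
  | @loop S' l hl =>
    obtain rfl : S' = S := hS
    rcases List.mem_append.1 ha with h' | h'
    · exact .inr h'
    · exact .inr (List.mem_singleton.1 h' ▸ hl.mem)
  | and _ _ ih ih' =>
    rcases ha with ha | ha
    · exact ih (Set.subset_union_left.trans hD) hS.1 ha
    · exact ih' (Set.subset_union_right.trans hD) hS.2 ha
  | orLeft _ ih => exact ih hD hS.1 ha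
  | orRight _ ih => exact ih hD hS.2 ha

/-! ### Foundedness -/

/-- The atoms derivable in at most `n` rounds from the rules whose bodies are contained in `D`. -/
def Stage (P : Program α) (D : Context α) : ℕ → α → Prop
  | 0, _ => False
  | n + 1, a => ∃ B ∈ bodies P a, ∀ b ∈ B, b ∈ D ∧ ∀ c, b = .pos c → Stage P D n c

/-- The atom is founded in `D`: it is derivable from the rules with bodies in `D`. -/
def Founded (P : Program α) (D : Context α) (a : α) : Prop := ∃ n, Stage P D n a

theorem Stage.succ {D : Context α} {n : ℕ} {a : α} (h : Stage P D n a) :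
    Stage P D (n + 1) a := by
  induction n generalizing a with
  | zero => exact h.elim
  | succ n ih =>
    obtain ⟨B, hB, h⟩ := h
    exact ⟨B, hB, fun b hb => ⟨(h b hb).1, fun c hc => ih ((h b hb).2 c hc)⟩⟩

theorem Stage.mono {D : Context α} {m n : ℕ} (hmn : m ≤ n) {a : α} (h : Stage P D m a) :
    Stage P D n a := by
  induction hmn with
  | refl => exact h
  | step _ ih => exact ih.succ

theorem Founded.of_body {D : Context α} {a : α} {B : List (Literal α)} (hB : B ∈ bodies P a)
    (h : ∀ b ∈ B, b ∈ D ∧ ∀ c, b = .pos c → Founded P D c) : Founded P D a := by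
  have bound : ∀ L : List (Literal α), (∀ b ∈ L, ∀ c, b = .pos c → Founded P D c) →
      ∃ n, ∀ b ∈ L, ∀ c, b = .pos c → Stage P D n c := by
    intro L
    induction L with
    | nil => exact fun _ => ⟨0, by simp⟩
    | cons x L ih =>
      intro hL
      obtain ⟨n, hn⟩ := ih fun b hb => hL b (List.mem_cons_of_mem _ hb)
      have hx : ∃ m, ∀ c, x = .pos c → Stage P D m c := by
        cases x with
        | pos c =>
          obtain ⟨m, hm⟩ := hL (.pos c) (by simp) c rfl
          exact ⟨m, fun c' hc' => by cases hc'; exact hm⟩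
        | neg c => exact ⟨0, nofun⟩
      obtain ⟨m, hm⟩ := hx
      refine ⟨max m n, fun b hb c hc => ?_⟩
      rcases List.mem_cons.1 hb with rfl | hb
      · exact (hm c hc).mono (le_max_left _ _)
      · exact (hn b hb c hc).mono (le_max_right _ _)
  obtain ⟨n, hn⟩ := bound B fun b hb => (h b hb).2
  exact ⟨n + 1, B, hB, fun b hb => ⟨(h b hb).1, hn b hb⟩⟩

/-- The first stage at which an atom is derivable; `0` for negative literals and for atoms that
are not founded. -/
noncomputable def rank (P : Program α) (D : Context α) : Literal α → ℕ
  | .pos a => sInf {n | Stage P D n a}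
  | .neg _ => 0

theorem Founded.exists_body {D : Context α} {a : α} (h : Founded P D a) :
    ∃ B ∈ bodies P a, ∀ b ∈ B, b ∈ D ∧ (b.IsAtom → rank P D b < rank P D (.pos a)) := by
  have hs : Stage P D (rank P D (.pos a)) a := Nat.sInf_mem h
  obtain ⟨m, hm⟩ : ∃ m, rank P D (.pos a) = m + 1 := by
    refine Nat.exists_eq_succ_of_ne_zero fun h0 => ?_
    rw [h0] at hs
    exact hs
  rw [hm] at hs ⊢
  obtain ⟨B, hB, hb⟩ := hs
  refine ⟨B, hB, fun b hbB => ⟨(hb b hbB).1, fun hat => ?_⟩⟩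
  cases b with
  | pos c => exact Nat.lt_succ_of_le (Nat.sInf_le ((hb _ hbB).2 c rfl))
  | neg c => exact hat.elim

/-- Below a chain whose unfounded atoms all lie in a purely positive final part `S₂`, a proof tree
shows its atoms founded: following unfounded atoms downwards, the tree could only end in a loop
that starts inside `S₂`, and such a loop is positive. -/
theorem Proves.eval_founded {Φ : Goal α} {C D : Context α} (h : Proves P Φ C) (hD : C ⊆ D)
    {S₁ S₂ : List (Literal α)} (h₁ : ∀ a, .pos a ∈ S₁ → Founded P D a)
    (h₂ : ∀ l ∈ S₂, l.IsAtom) (hS : HasChain (S₁ ++ S₂) Φ) :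
    Φ.Eval (fun _ => True) (fun _ l => l ∈ D ∧ ∀ a, l = .pos a → Founded P D a) := by
  induction h generalizing S₂ with
  | tru C => trivial
  | @expand S l C hl h ih =>
    obtain rfl : S = S₁ ++ S₂ := hS
    refine ⟨hD (Proves.expand hl h).mem, ?_⟩
    rintro a rfl
    have := ih hD (S₂ := S₂ ++ [.pos a])
      (fun x hx => (List.mem_append.1 hx).elim (h₂ x)
        fun hx => List.mem_singleton.1 hx ▸ trivial)
      (by rw [← List.append_assoc]; exact hasChain_derivedGoal _ _)
    obtain ⟨B, hB, hb⟩ := (eval_derivedGoal_pos (t := fun _ => True) trivial).1 this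
    exact .of_body hB hb
  | @loop S l hl =>
    obtain rfl : S = S₁ ++ S₂ := hS
    refine ⟨hD (Proves.loop (P := P) hl).mem, ?_⟩
    rintro a rfl
    obtain ⟨M, hM, x, hx, hxa⟩ := hl.exists_suffix
    rw [List.append_assoc] at hM
    -- Either the loop lies in the positive part, or `a` is a member of `S₁`.
    rcases List.suffix_or_suffix_of_suffix hM (List.suffix_append S₁ (S₂ ++ [.pos a])) with h | h
    · refine (hxa ?_).elim
      rcases List.mem_append.1 (h.subset hx) with hx | hx
      · exact h₂ x hx
      · exact List.mem_singleton.1 hx ▸ trivial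
    · obtain ⟨T, hT⟩ := h
      cases T with
      | nil =>
        refine (hxa ?_).elim
        rw [← hT, List.nil_append] at hx
        rcases List.mem_append.1 hx with hx | hx
        · exact h₂ x hx
        · exact List.mem_singleton.1 hx ▸ trivial
      | cons y T =>
        obtain rfl : y = .pos a := by
          have := congrArg List.head? hT
          simpa using this
        rw [← hT] at hM
        obtain ⟨A, hA⟩ := hM
        refine h₁ a ?_
        rw [← List.append_assoc] at hA
        rw [← List.append_cancel_right hA]
        simp
  | and _ _ ih ih' =>
    exact ⟨ih (Set.subset_union_left.trans hD) h₂ hS.1,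
      ih' (Set.subset_union_right.trans hD) h₂ hS.2⟩
  | orLeft _ ih => exact .inl (ih hD h₂ hS.1)
  | orRight _ ih => exact .inr (ih hD h₂ hS.2)

theorem Proves.founded {Φ : Goal α} {C D : Context α} (h : Proves P Φ C) (hD : C ⊆ D)
    {S : List (Literal α)} (hS : HasChain S Φ) (hF : ∀ a, .pos a ∈ S → Founded P D a)
    {a : α} (ha : .pos a ∈ C) : Founded P D a := by
  induction h generalizing S with
  | tru C =>
    obtain rfl : C = chainSet S := hS
    exact hF a ha
  | @expand S' l C hl h ih =>
    obtain rfl : S' = S := hS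
    have hlit := (Proves.expand hl h).eval_founded hD (S₂ := []) hF (by simp)
      (show S' = S' ++ [] by simp)
    refine ih hD (hasChain_derivedGoal S' l) (fun b hb => ?_) ha
    rcases List.mem_append.1 hb with hb | hb
    · exact hF b hb
    · exact hlit.2 b (List.mem_singleton.1 hb).symm
  | @loop S' l hl =>
    obtain rfl : S' = S := hS
    rcases List.mem_append.1 ha with ha | ha
    · exact hF a ha
    · exact hF a (List.mem_singleton.1 ha ▸ hl.mem)
  | and _ _ ih ih' =>
    rcases ha with ha | ha
    · exact ih (Set.subset_union_left.trans hD) hS.1 hF ha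
    · exact ih' (Set.subset_union_right.trans hD) hS.2 hF ha
  | orLeft _ ih => exact ih hD hS.1 hF ha
  | orRight _ ih => exact ih hD hS.2 hF ha

/-! ### Partial stable models -/

/-- A consistent set of literals in which all negative literals are supported and all atoms are
founded. -/
structure IsPartialStable (P : Program α) (D : Context α) : Prop where
  consistent : Consistent D
  support : ∀ a, .neg a ∈ D → ∀ B ∈ bodies P a, ∃ b ∈ B, b.compl ∈ D
  founded : ∀ a, .pos a ∈ D → Founded P D a

theorem RewritesTo.isPartialStable {g : Literal α} {E : Goal α}
    (h : RewritesTo P noComputedRules g E) {D : Context α} (hD : D ∈ E.contexts) :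
    IsPartialStable P D := by
  have hp : Proves P (.lit [] g) D := (proves_of_mem_contexts hD).of_steps h
  have hS : HasChain [] (.lit [] g) := rfl
  refine ⟨((Rooted.of_rewritesTo h).of_mem_contexts hD).1, fun a ha => ?_, fun a ha => ?_⟩
  · exact (hp.support subset_rfl hS ha).resolve_right List.not_mem_nil
  · exact hp.founded subset_rfl hS (by simp) ha

/-- The goal is true in `D` when literals count as true if their chain lies in `D` and the rank
decreases from each atom to a directly following atom, which excludes positive loops. -/
def TrueIn (P : Program α) (D : Context α) : Goal α → Prop :=
  Goal.Eval (fun C => C ⊆ D) fun S l => chainSet (S ++ [l]) ⊆ D ∧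
    (S ++ [l]).IsChain fun x y => x.IsAtom → y.IsAtom → rank P D y < rank P D x

theorem not_isPositiveLoop {D : Context α} {S : List (Literal α)}
    (h : S.IsChain fun x y => x.IsAtom → y.IsAtom → rank P D y < rank P D x) :
    ¬ IsPositiveLoop S := by
  rintro ⟨⟨l, M, rfl⟩, hat⟩
  have h' : (l :: M ++ [l]).IsChain fun x y => rank P D y < rank P D x :=
    h.imp_of_mem_imp fun x y hx hy hxy => hxy (hat x hx) (hat y hy)
  have : Trans (fun x y : Literal α => rank P D y < rank P D x)
      (fun x y => rank P D y < rank P D x) (fun x y => rank P D y < rank P D x) :=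
    ⟨fun h h' => lt_trans h' h⟩
  exact lt_irrefl _ (List.IsChain.rel_cons (R := fun x y => rank P D y < rank P D x) (b := l) h' (by simp))

/-- Truth in a partial stable model is preserved by rewriting in the original system. -/
theorem TrueIn.step {D : Context α} (hD : IsPartialStable P D) {Φ Φ' : Goal α}
    (hs : Step P noComputedRules Φ Φ') (h : TrueIn P D Φ) : TrueIn P D Φ' := by
  induction hs with
  | @program S l hl _ =>
    obtain ⟨hsub, hch⟩ := h
    have hsub' : ∀ b ∈ D, chainSet (S ++ [l] ++ [b]) ⊆ D := by
      intro b hb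
      rw [chainSet_append]
      refine Set.union_subset hsub fun x hx => ?_
      obtain rfl := List.mem_singleton.1 hx
      exact hb
    have hl : l ∈ D := hsub (List.mem_append_right _ (List.mem_singleton_self l))
    cases l with
    | pos a =>
      obtain ⟨B, hB, hb⟩ := (hD.founded a hl).exists_body
      refine (eval_derivedGoal_pos hsub).2 ⟨B, hB, fun b hbB => ⟨hsub' b (hb b hbB).1, ?_⟩⟩
      refine hch.append (.singleton b) fun x hx y hy => ?_
      simp only [List.getLast?_concat, Option.mem_some_iff, List.head?_cons] at hx hy
      subst hx hy
      exact fun _ => (hb b hbB).2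
    | neg a =>
      refine (eval_derivedGoal_neg hsub).2 fun B hB => ?_
      obtain ⟨b, hbB, hb⟩ := hD.support a hl B hB
      refine ⟨b, hbB, hsub' _ hb, hch.append (.singleton _) fun x hx y _ => ?_⟩
      simp only [List.getLast?_concat, Option.mem_some_iff] at hx
      subst hx
      exact nofun
  | recycle _ hR => cases hR
  | lr1 hl =>
    obtain ⟨S', hS', hl | ⟨x, M, rfl⟩⟩ := hl
    · exact (not_isPositiveLoop (h.2.suffix hS') hl).elim
    · exact (hD.consistent x (h.1 (hS'.subset (by simp))) (h.1 (hS'.subset (by simp)))).elim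
  | lr2 hl => exact h.1
  | sr1 => exact h.resolve_left id
  | sr1' => exact h.resolve_right id
  | sr2 => exact h.1
  | sr2' => exact h.2
  | sr3 hC => exact Set.union_subset h.1 h.2
  | sr4 hC =>
    have hsub := Set.union_subset h.1 h.2
    exact hC fun l hl hl' => hD.consistent l (hsub hl) (hsub hl')
  | sr5 => exact h.2.imp (⟨h.1, ·⟩) (⟨h.1, ·⟩)
  | sr5' => exact h.1.imp (⟨·, h.2⟩) (⟨·, h.2⟩)
  | andLeft _ ih => exact ⟨ih h.1, h.2⟩
  | andRight _ ih => exact ⟨h.1, ih h.2⟩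
  | orLeft _ ih => exact h.imp_left ih
  | orRight _ ih => exact h.imp_right ih

/-- A literal that belongs to a partial stable model does not rewrite to `F`. -/
theorem IsPartialStable.not_rewritesTo_fls {D : Context α} (hD : IsPartialStable P D)
    {p : Literal α} (hp : p ∈ D) : ¬ RewritesTo P noComputedRules p .fls := by
  intro h
  have hstart : TrueIn P D (.lit [] p) := by
    refine ⟨fun x hx => ?_, .singleton p⟩
    obtain rfl := List.mem_singleton.1 hx
    exact hp
  have : ∀ {Φ}, Steps P noComputedRules (.lit [] p) Φ → TrueIn P D Φ := by
    intro Φ hs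
    induction hs with
    | refl => exact hstart
    | tail _ hs ih => exact ih.step hD hs
  exact this h

/-! ### Pruning the goals that depend on given literals -/

namespace Goal

open Classical in
/-- Conjunction, simplified to `F` if one of the conjuncts is `F`. -/
noncomputable def meet (Φ Ψ : Goal α) : Goal α :=
  if Φ = fls ∨ Ψ = fls then fls else and Φ Ψ

open Classical in
/-- Disjunction, without the disjuncts that are `F`. -/
noncomputable def join (Φ Ψ : Goal α) : Goal α :=
  if Φ = fls then Ψ else if Ψ = fls then Φ else or Φ Ψ

open Classical in
/-- The goal with all contexts and all literals replaced by `F` whose context or chain contains a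
literal of `X`, with `F` eliminated from disjunctions and conjunctions. -/
noncomputable def prune (X : Set (Literal α)) : Goal α → Goal α
  | fls => fls
  | tru C => if Disjoint C X then tru C else fls
  | lit S l => if Disjoint (chainSet (S ++ [l])) X then lit S l else fls
  | and Φ Ψ => meet (Φ.prune X) (Ψ.prune X)
  | or Φ Ψ => join (Φ.prune X) (Ψ.prune X)

@[simp] theorem meet_fls (Φ : Goal α) : meet Φ fls = fls := by simp [meet]

@[simp] theorem fls_meet (Φ : Goal α) : meet fls Φ = fls := by simp [meet]

@[simp] theorem join_fls (Φ : Goal α) : join Φ fls = Φ := by simp [join]; exact Eq.symm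

@[simp] theorem fls_join (Φ : Goal α) : join fls Φ = Φ := by simp [join]

theorem meet_of_ne {Φ Ψ : Goal α} (h : Φ ≠ fls) (h' : Ψ ≠ fls) : meet Φ Ψ = and Φ Ψ := by
  simp [meet, h, h']

theorem meet_tru (C D : Context α) : meet (tru C) (tru D) = and (tru C) (tru D) :=
  meet_of_ne nofun nofun

theorem join_of_ne {Φ Ψ : Goal α} (h : Φ ≠ fls) (h' : Ψ ≠ fls) : join Φ Ψ = or Φ Ψ := by
  simp [join, h, h']

end Goal

open Goal

theorem steps_meet (Φ Ψ : Goal α) : Steps P R (.and Φ Ψ) (meet Φ Ψ) := by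
  by_cases h : Φ = fls
  · subst h; rw [fls_meet]; exact .single .sr2
  by_cases h' : Ψ = fls
  · subst h'; rw [meet_fls]; exact .single .sr2'
  rw [meet_of_ne h h']

theorem steps_join (Φ Ψ : Goal α) : Steps P R (.or Φ Ψ) (join Φ Ψ) := by
  by_cases h : Φ = fls
  · subst h; rw [fls_join]; exact .single .sr1
  by_cases h' : Ψ = fls
  · subst h'; rw [join_fls]; exact .single .sr1'
  rw [join_of_ne h h']

theorem eq_fls_of_steps {Φ : Goal α} (h : Steps P R .fls Φ) : Φ = .fls :=
  IsAnswer.eq_of_steps (.inl rfl) h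

theorem Steps.meet {Φ Φ' Ψ Ψ' : Goal α} (h : Steps P R Φ Φ') (h' : Steps P R Ψ Ψ') :
    Steps P R (meet Φ Ψ) (meet Φ' Ψ') := by
  by_cases hΦ : Φ = fls
  · subst hΦ
    rw [eq_fls_of_steps h, fls_meet, fls_meet]
  by_cases hΨ : Ψ = fls
  · subst hΨ
    rw [eq_fls_of_steps h', meet_fls, meet_fls]
  rw [meet_of_ne hΦ hΨ]
  exact (h.and h').trans (steps_meet _ _)

theorem Steps.join {Φ Φ' Ψ Ψ' : Goal α} (h : Steps P R Φ Φ') (h' : Steps P R Ψ Ψ') :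
    Steps P R (join Φ Ψ) (join Φ' Ψ') := by
  by_cases hΦ : Φ = fls
  · subst hΦ
    rw [eq_fls_of_steps h, fls_join, fls_join]
    exact h'
  by_cases hΨ : Ψ = fls
  · subst hΨ
    rw [eq_fls_of_steps h', join_fls, join_fls]
    exact h
  rw [join_of_ne hΦ hΨ]
  exact (h.or h').trans (steps_join _ _)

/-- The literals whose rule has been replaced by `p → F`. -/
def failing (R : ComputedRules α) : Set (Literal α) := {p | R p = some .fls}

theorem prune_eq_fls {X : Set (Literal α)} : ∀ {Φ : Goal α},
    Φ.All (fun C => ¬ Disjoint C X) (fun S _ => ¬ Disjoint (chainSet S) X) → Φ.prune X = .fls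
  | .fls, _ => rfl
  | .tru _, h => if_neg h
  | .lit S l, h => if_neg fun h' => h (h'.mono_left (by
      rw [chainSet_append]; exact Set.subset_union_left))
  | .and _ _, h => by rw [prune, prune_eq_fls h.1, fls_meet]
  | .or _ _, h => by rw [prune, prune_eq_fls h.1, prune_eq_fls h.2, fls_join]

theorem recycled_fls (S : List (Literal α)) : recycled S (.fls : Goal α) = .fls := rfl

theorem disjoint_chainSet_concat {S : List (Literal α)} {l : Literal α} {X : Set (Literal α)} :
    Disjoint (chainSet (S ++ [l])) X ↔ Disjoint (chainSet S) X ∧ l ∉ X := by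
  have : chainSet [l] = {l} := by ext; simp [chainSet]
  rw [chainSet_append, Set.disjoint_union_left, this, Set.disjoint_singleton_left]

/-- Literals with a rule `p → F` can be rewritten to `F` as soon as they occur. -/
theorem steps_prune : ∀ {Φ : Goal α},
    Φ.All (fun C => Disjoint C (failing R)) (fun S _ => Disjoint (chainSet S) (failing R)) →
      Steps P R Φ (Φ.prune (failing R))
  | .fls, _ => .refl
  | .tru C, h => by
    have h' : Disjoint C (failing R) := h
    rw [prune, if_pos h']
  | .lit S l, h => by
    rw [prune]
    split_ifs with hd
    · exact .refl
    have hl : l ∈ failing R := by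
      by_contra hl
      exact hd (disjoint_chainSet_concat.2 ⟨h, hl⟩)
    by_cases hloop : EndsInLoop (S ++ [l])
    · rcases hloop with hloop | hloop
      · exact .single (.lr1 hloop)
      · exact (Set.disjoint_left.1 h hloop.mem hl).elim
    · exact .single (recycled_fls (S ++ [l]) ▸ .recycle hloop hl)
  | .and _ _, h => ((steps_prune h.1).and (steps_prune h.2)).trans (steps_meet _ _)
  | .or _ _, h => ((steps_prune h.1).or (steps_prune h.2)).trans (steps_join _ _)

/-- Pruning turns each rewrite step of the original system into a rewrite sequence of the system
with computed rules. -/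
theorem Step.prune (hR : ∀ p E, R p = some E → E = .fls) {Φ Φ' : Goal α}
    (h : Step P noComputedRules Φ Φ') :
    Steps P R (Φ.prune (failing R)) (Φ'.prune (failing R)) := by
  induction h with
  | @program S l hl _ =>
    rw [Goal.prune]
    split_ifs with hd
    · have hnone : R l = none := by
        cases hE : R l with
        | none => rfl
        | some E =>
          have : l ∈ failing R := by rw [hR l E hE] at hE; exact hE
          exact ((disjoint_chainSet_concat.1 hd).2 this).elim
      exact .head (.program hl hnone) (steps_prune (all_derivedGoal hd fun _ _ _ _ => hd))
    · rw [prune_eq_fls (all_derivedGoal hd fun _ _ _ _ => hd)]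
  | recycle _ hE => cases hE
  | @lr1 S l hl =>
    simp only [Goal.prune]
    split_ifs
    · exact .single (.lr1 hl)
    · exact .refl
  | @lr2 S l hl =>
    simp only [Goal.prune]
    split_ifs
    · exact .single (.lr2 hl)
    · exact .refl
  | sr1 => simp only [Goal.prune, fls_join]; exact .refl
  | sr1' => simp only [Goal.prune, join_fls]; exact .refl
  | sr2 => simp only [Goal.prune, fls_meet]; exact .refl
  | sr2' => simp only [Goal.prune, meet_fls]; exact .refl
  | @sr3 C₁ C₂ hC =>
    have hu : Disjoint (C₁ ∪ C₂) (failing R) ↔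
      Disjoint C₁ (failing R) ∧ Disjoint C₂ (failing R) := Set.disjoint_union_left
    simp only [Goal.prune]
    by_cases h1 : Disjoint C₁ (failing R)
    · by_cases h2 : Disjoint C₂ (failing R)
      · rw [if_pos h1, if_pos h2, if_pos (hu.2 ⟨h1, h2⟩), meet_tru]
        exact .single (.sr3 hC)
      · rw [if_neg h2, if_neg fun h => h2 (hu.1 h).2, meet_fls]
    · rw [if_neg h1, if_neg fun h => h1 (hu.1 h).1, fls_meet]
  | sr4 hC =>
    simp only [Goal.prune]
    split_ifs
    · rw [meet_tru]
      exact .single (.sr4 hC)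
    all_goals simp only [meet_fls, fls_meet]; exact .refl
  | @sr5 Φ₁ Φ₂ Φ₃ =>
    simp only [Goal.prune]
    by_cases h1 : Φ₁.prune (failing R) = .fls
    · simp only [h1, fls_meet, fls_join]; exact .refl
    by_cases h2 : Φ₂.prune (failing R) = .fls
    · simp only [h2, meet_fls, fls_join]; exact .refl
    by_cases h3 : Φ₃.prune (failing R) = .fls
    · simp only [h3, meet_fls, join_fls]; exact .refl
    rw [join_of_ne h2 h3, meet_of_ne h1 h2, meet_of_ne h1 h3, meet_of_ne h1 (Ψ := .or _ _) nofun,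
      join_of_ne (Φ := .and _ _) (Ψ := .and _ _) nofun nofun]
    exact .single .sr5
  | @sr5' Φ₁ Φ₂ Φ₃ =>
    simp only [Goal.prune]
    by_cases h3 : Φ₃.prune (failing R) = .fls
    · simp only [h3, meet_fls, fls_join]; exact .refl
    by_cases h1 : Φ₁.prune (failing R) = .fls
    · simp only [h1, fls_meet, fls_join]; exact .refl
    by_cases h2 : Φ₂.prune (failing R) = .fls
    · simp only [h2, fls_meet, join_fls]; exact .refl
    rw [join_of_ne h1 h2, meet_of_ne h1 h3, meet_of_ne h2 h3, meet_of_ne (Φ := .or _ _) nofun h3,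
      join_of_ne (Φ := .and _ _) (Ψ := .and _ _) nofun nofun]
    exact .single .sr5'
  | andLeft _ ih => exact ih.meet .refl
  | andRight _ ih => exact Steps.meet .refl ih
  | orLeft _ ih => exact ih.join .refl
  | orRight _ ih => exact Steps.join .refl ih

theorem Steps.prune (hR : ∀ p E, R p = some E → E = .fls) {Φ Φ' : Goal α}
    (h : Steps P noComputedRules Φ Φ') :
    Steps P R (Φ.prune (failing R)) (Φ'.prune (failing R)) := by
  induction h with
  | refl => exact .refl
  | tail _ hs ih => exact ih.trans (hs.prune hR)

theorem Goal.IsDisj.prune_eq {X : Set (Literal α)} : ∀ {E : Goal α}, E.IsDisj →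
    (∀ C ∈ E.contexts, Disjoint C X) → E.prune X = E
  | .tru C, _, h => if_pos (h C (List.mem_singleton_self C))
  | .or Φ Ψ, hE, h => by
    rw [prune, hE.1.prune_eq fun C hC => h C (List.mem_append_left _ hC),
      hE.2.prune_eq fun C hC => h C (List.mem_append_right _ hC)]
    refine join_of_ne ?_ ?_
    · rintro rfl; exact hE.1
    · rintro rfl; exact hE.2
  | .fls, h, _ | .lit _ _, h, _ | .and _ _, h, _ => h.elim

theorem Goal.IsAnswer.prune_eq {X : Set (Literal α)} {E : Goal α} (hE : E.IsAnswer)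
    (h : ∀ C ∈ E.contexts, Disjoint C X) : E.prune X = E := by
  rcases hE with rfl | hE
  · rfl
  · exact hE.prune_eq h

/-- A literal that rewrites to `F` belongs to no context of a normal form in the original
system. -/
theorem RewritesTo.disjoint_failing
    (hR : ∀ p ∈ failing R, RewritesTo P noComputedRules p .fls) {g : Literal α} {E : Goal α}
    (h : RewritesTo P noComputedRules g E) {C : Context α} (hC : C ∈ E.contexts) :
    Disjoint C (failing R) :=
  Set.disjoint_left.2 fun p hp hp' =>
    (RewritesTo.isPartialStable h hC).not_rewritesTo_fls hp (hR p hp')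

/-- Every normal form of the original system is a normal form of the system with computed rules:
prune the whole rewrite sequence. -/
theorem RewritesTo.of_noComputedRules (hfail : ∀ p E, R p = some E → E = .fls)
    (hR : ∀ p ∈ failing R, RewritesTo P noComputedRules p .fls) {g : Literal α} {E : Goal α}
    (hE : E.IsAnswer) (h : RewritesTo P noComputedRules g E) : RewritesTo P R g E := by
  have h1 := Steps.prune hfail h
  rw [hE.prune_eq fun C hC => h.disjoint_failing hR hC] at h1
  exact (steps_prune (Φ := .lit [] g) (Set.disjoint_left.2 fun _ hx => (List.not_mem_nil hx).elim)).trans h1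

/-! ### Padding with doomed disjuncts -/

/-- `Padded X Φ Ψ`: the goal `Ψ` is obtained from `Φ` by replacing occurrences of `F` by goals that
`prune X` turns into `F`, and by adding such goals as disjuncts to subgoals. -/
inductive Padded (X : Set (Literal α)) : Goal α → Goal α → Prop
  | fls {Ψ} : Ψ.prune X = .fls → Padded X .fls Ψ
  | tru C : Padded X (.tru C) (.tru C)
  | lit S l : Padded X (.lit S l) (.lit S l)
  | and {Φ₁ Φ₂ Ψ₁ Ψ₂} : Padded X Φ₁ Ψ₁ → Padded X Φ₂ Ψ₂ → Padded X (.and Φ₁ Φ₂) (.and Ψ₁ Ψ₂)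
  | or {Φ₁ Φ₂ Ψ₁ Ψ₂} : Padded X Φ₁ Ψ₁ → Padded X Φ₂ Ψ₂ → Padded X (.or Φ₁ Φ₂) (.or Ψ₁ Ψ₂)
  | padLeft {Φ Θ Ψ} : Θ.prune X = .fls → Padded X Φ Ψ → Padded X Φ (.or Θ Ψ)
  | padRight {Φ Θ Ψ} : Θ.prune X = .fls → Padded X Φ Ψ → Padded X Φ (.or Ψ Θ)

/-- `Ψ` is obtained from `Φ` by adding disjuncts at the root that `prune X` turns into `F`. -/
inductive RootPadded (X : Set (Literal α)) (Φ : Goal α) : Goal α → Prop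
  | refl : RootPadded X Φ Φ
  | padLeft {Θ Ψ} : Θ.prune X = .fls → RootPadded X Φ Ψ → RootPadded X Φ (.or Θ Ψ)
  | padRight {Θ Ψ} : Θ.prune X = .fls → RootPadded X Φ Ψ → RootPadded X Φ (.or Ψ Θ)

variable {X : Set (Literal α)}

theorem Padded.refl : ∀ Φ : Goal α, Padded X Φ Φ
  | .fls => .fls rfl
  | .tru C => .tru C
  | .lit S l => .lit S l
  | .and Φ Ψ => .and (refl Φ) (refl Ψ)
  | .or Φ Ψ => .or (refl Φ) (refl Ψ)

theorem RootPadded.padded {Φ Ψ Ψ' : Goal α} (h : Padded X Φ Ψ) (h' : RootPadded X Ψ Ψ') :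
    Padded X Φ Ψ' := by
  induction h' with
  | refl => exact h
  | padLeft hΘ _ ih => exact .padLeft hΘ ih
  | padRight hΘ _ ih => exact .padRight hΘ ih

theorem RootPadded.steps {Φ Φ' Ψ : Goal α} (h : RootPadded X Φ Ψ) (hs : Steps P R Φ Φ') :
    ∃ Ψ', Steps P R Ψ Ψ' ∧ RootPadded X Φ' Ψ' := by
  induction h with
  | refl => exact ⟨_, hs, .refl⟩
  | padLeft hΘ _ ih =>
    obtain ⟨Ψ', hs, hp⟩ := ih
    exact ⟨_, Steps.or .refl hs, .padLeft hΘ hp⟩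
  | padRight hΘ _ ih =>
    obtain ⟨Ψ', hs, hp⟩ := ih
    exact ⟨_, Steps.or hs .refl, .padRight hΘ hp⟩

/-- Root padding of conjuncts can be moved to the root of the conjunction by distribution. -/
theorem RootPadded.and {Φ Ψ Φ' Ψ' : Goal α} (h : RootPadded X Φ Φ') (h' : RootPadded X Ψ Ψ') :
    ∃ Ω, Steps P R (.and Φ' Ψ') Ω ∧ RootPadded X (.and Φ Ψ) Ω := by
  induction h with
  | refl =>
    induction h' with
    | refl => exact ⟨_, .refl, .refl⟩
    | padLeft hΘ _ ih =>
      obtain ⟨Ω, hs, hp⟩ := ih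
      exact ⟨_, .head .sr5 (Steps.or .refl hs), .padLeft (by rw [prune, hΘ, meet_fls]) hp⟩
    | padRight hΘ _ ih =>
      obtain ⟨Ω, hs, hp⟩ := ih
      exact ⟨_, .head .sr5 (Steps.or hs .refl), .padRight (by rw [prune, hΘ, meet_fls]) hp⟩
  | padLeft hΘ _ ih =>
    obtain ⟨Ω, hs, hp⟩ := ih
    exact ⟨_, .head .sr5' (Steps.or .refl hs), .padLeft (by rw [prune, hΘ, fls_meet]) hp⟩
  | padRight hΘ _ ih =>
    obtain ⟨Ω, hs, hp⟩ := ih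
    exact ⟨_, .head .sr5' (Steps.or hs .refl), .padRight (by rw [prune, hΘ, fls_meet]) hp⟩

theorem Padded.prune_eq_fls {Ψ : Goal α} (h : Padded X .fls Ψ) : Ψ.prune X = .fls := by
  generalize hΦ : (Goal.fls : Goal α) = Φ at h
  induction h with
  | fls h => exact h
  | padLeft hΘ _ ih => rw [prune, hΘ, ih hΦ, fls_join]
  | padRight hΘ _ ih => rw [prune, hΘ, join_fls, ih hΦ]
  | tru | lit | and | or => cases hΦ

theorem Padded.exists_tru {C : Context α} {Ψ : Goal α} (h : Padded X (.tru C) Ψ) :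
    RootPadded X (.tru C) Ψ := by
  generalize hΦ : Goal.tru C = Φ at h
  induction h with
  | tru => cases hΦ; exact .refl
  | padLeft hΘ _ ih => exact .padLeft hΘ (ih hΦ)
  | padRight hΘ _ ih => exact .padRight hΘ (ih hΦ)
  | fls | lit | and | or => cases hΦ

theorem Padded.exists_or {Φ₁ Φ₂ Ψ : Goal α} (h : Padded X (.or Φ₁ Φ₂) Ψ) :
    ∃ Ψ₁ Ψ₂, Padded X Φ₁ Ψ₁ ∧ Padded X Φ₂ Ψ₂ ∧ RootPadded X (.or Ψ₁ Ψ₂) Ψ := by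
  generalize hΦ : Goal.or Φ₁ Φ₂ = Φ at h
  induction h with
  | or h1 h2 => cases hΦ; exact ⟨_, _, h1, h2, .refl⟩
  | padLeft hΘ _ ih =>
    obtain ⟨_, _, h1, h2, hp⟩ := ih hΦ
    exact ⟨_, _, h1, h2, .padLeft hΘ hp⟩
  | padRight hΘ _ ih =>
    obtain ⟨_, _, h1, h2, hp⟩ := ih hΦ
    exact ⟨_, _, h1, h2, .padRight hΘ hp⟩
  | fls | lit | and | tru => cases hΦ

/-- The original system simulates a step of the system with computed rules `p → F`, up to padding:
instead of rewriting `p` to `F`, it keeps `p` as a part that prunes to `F`. -/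
theorem Padded.step (hfail : ∀ p E, R p = some E → E = .fls) {Φ Φ' Ψ : Goal α}
    (h : Padded (failing R) Φ Ψ) (hs : Step P R Φ Φ') :
    ∃ Ψ', Steps P noComputedRules Ψ Ψ' ∧ Padded (failing R) Φ' Ψ' := by
  induction h generalizing Φ' with
  | fls _ => cases hs
  | tru _ => cases hs
  | lit S l =>
    cases hs with
    | program hl _ => exact ⟨_, .single (.program hl rfl), .refl _⟩
    | recycle hl hE =>
      obtain rfl := hfail _ _ hE
      refine ⟨_, .refl, .fls (if_neg fun h => ?_)⟩
      exact (disjoint_chainSet_concat.1 h).2 hE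
    | lr1 hl => exact ⟨_, .single (.lr1 hl), .refl _⟩
    | lr2 hl => exact ⟨_, .single (.lr2 hl), .refl _⟩
  | padLeft hΘ _ ih =>
    obtain ⟨Ψ', hs', hp⟩ := ih hs
    exact ⟨_, Steps.or .refl hs', .padLeft hΘ hp⟩
  | padRight hΘ _ ih =>
    obtain ⟨Ψ', hs', hp⟩ := ih hs
    exact ⟨_, Steps.or hs' .refl, .padRight hΘ hp⟩
  | or h1 h2 ih1 ih2 =>
    cases hs with
    | sr1 => exact ⟨_, .refl, .padLeft h1.prune_eq_fls h2⟩
    | sr1' => exact ⟨_, .refl, .padRight h2.prune_eq_fls h1⟩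
    | orLeft hs =>
      obtain ⟨Ψ', hs', hp⟩ := ih1 hs
      exact ⟨_, Steps.or hs' .refl, .or hp h2⟩
    | orRight hs =>
      obtain ⟨Ψ', hs', hp⟩ := ih2 hs
      exact ⟨_, Steps.or .refl hs', .or h1 hp⟩
  | and h1 h2 ih1 ih2 =>
    cases hs with
    | sr2 => exact ⟨_, .refl, .fls (by rw [prune, h1.prune_eq_fls, fls_meet])⟩
    | sr2' => exact ⟨_, .refl, .fls (by rw [prune, h2.prune_eq_fls, meet_fls])⟩
    | sr3 hC =>
      obtain ⟨Ω, hs, hp⟩ := h1.exists_tru.and h2.exists_tru (P := P) (R := noComputedRules)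
      obtain ⟨Ω', hs', hp'⟩ := hp.steps (.single (Step.sr3 hC))
      exact ⟨Ω', hs.trans hs', hp'.padded (.tru _)⟩
    | sr4 hC =>
      obtain ⟨Ω, hs, hp⟩ := h1.exists_tru.and h2.exists_tru (P := P) (R := noComputedRules)
      obtain ⟨Ω', hs', hp'⟩ := hp.steps (.single (Step.sr4 hC))
      exact ⟨Ω', hs.trans hs', hp'.padded (.fls rfl)⟩
    | sr5 =>
      obtain ⟨_, _, h3, h4, hp⟩ := h2.exists_or
      obtain ⟨Ω, hs, hp⟩ := RootPadded.refl.and hp (P := P) (R := noComputedRules)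
      obtain ⟨Ω', hs', hp'⟩ := hp.steps (.single Step.sr5)
      exact ⟨Ω', hs.trans hs', hp'.padded (.or (.and h1 h3) (.and h1 h4))⟩
    | sr5' =>
      obtain ⟨_, _, h3, h4, hp⟩ := h1.exists_or
      obtain ⟨Ω, hs, hp⟩ := hp.and .refl (P := P) (R := noComputedRules)
      obtain ⟨Ω', hs', hp'⟩ := hp.steps (.single Step.sr5')
      exact ⟨Ω', hs.trans hs', hp'.padded (.or (.and h3 h2) (.and h4 h2))⟩
    | andLeft hs =>
      obtain ⟨Ψ', hs', hp⟩ := ih1 hs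
      exact ⟨_, Steps.and hs' .refl, .and hp h2⟩
    | andRight hs =>
      obtain ⟨Ψ', hs', hp⟩ := ih2 hs
      exact ⟨_, Steps.and .refl hs', .and h1 hp⟩

/-- No normal form of the goal in the original system has a context that meets `X`. -/
def AvoidsContexts (P : Program α) (X : Set (Literal α)) (Φ : Goal α) : Prop :=
  ∀ E : Goal α, Steps P noComputedRules Φ E → E.IsAnswer → ∀ C ∈ E.contexts, Disjoint C X

theorem AvoidsContexts.of_or {Φ Ψ : Goal α} (h : AvoidsContexts P X (.or Φ Ψ)) :
    AvoidsContexts P X Φ ∧ AvoidsContexts P X Ψ := by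
  refine ⟨fun E hs hE C hC => ?_, fun E hs hE C hC => ?_⟩
  · obtain ⟨E', hs', hE'⟩ := normalizes P Ψ
    obtain ⟨F, hF, hA, hc⟩ := hE.or_steps (P := P) (R := noComputedRules) hE'
    exact h F ((hs.or hs').trans hF) hA C (hc ▸ List.mem_append_left _ hC)
  · obtain ⟨E', hs', hE'⟩ := normalizes P Φ
    obtain ⟨F, hF, hA, hc⟩ := hE'.or_steps (P := P) (R := noComputedRules) hE
    exact h F ((hs'.or hs).trans hF) hA C (hc ▸ List.mem_append_right _ hC)

/-- A goal that prunes to `F` and none of whose normal forms has a context affected by pruning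
rewrites to `F`. -/
theorem AvoidsContexts.steps_fls (hfail : ∀ p E, R p = some E → E = .fls) {Φ : Goal α}
    (h : AvoidsContexts P (failing R) Φ) (hΦ : Φ.prune (failing R) = .fls) :
    Steps P noComputedRules Φ .fls := by
  obtain ⟨E, hs, hE⟩ := normalizes P Φ
  have h1 := Steps.prune hfail hs
  rw [hΦ, hE.prune_eq (h E hs hE)] at h1
  exact eq_fls_of_steps h1 ▸ hs

theorem Padded.steps_of_avoidsContexts (hfail : ∀ p E, R p = some E → E = .fls) {E Ψ : Goal α}
    (h : Padded (failing R) E Ψ) (hE : E.IsAnswer) (hΨ : AvoidsContexts P (failing R) Ψ) :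
    Steps P noComputedRules Ψ E := by
  induction h with
  | fls h => exact hΨ.steps_fls hfail h
  | tru _ => exact .refl
  | lit _ _ => exact (hE.resolve_left nofun).elim
  | and _ _ => exact (hE.resolve_left nofun).elim
  | or _ _ ih1 ih2 =>
    have hE' := hE.resolve_left nofun
    exact (ih1 (.inr hE'.1) hΨ.of_or.1).or (ih2 (.inr hE'.2) hΨ.of_or.2)
  | padLeft hΘ _ ih =>
    exact ((hΨ.of_or.1.steps_fls hfail hΘ).or (ih hE hΨ.of_or.2)).tail .sr1
  | padRight hΘ _ ih =>
    exact ((ih hE hΨ.of_or.1).or (hΨ.of_or.2.steps_fls hfail hΘ)).tail .sr1'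

/-- Every normal form of the system with computed rules is a normal form of the original system:
simulate up to padding, and rewrite the padding to `F` at the end. -/
theorem RewritesTo.to_noComputedRules (hfail : ∀ p E, R p = some E → E = .fls)
    (hR : ∀ p ∈ failing R, RewritesTo P noComputedRules p .fls) {g : Literal α} {E : Goal α}
    (hE : E.IsAnswer) (h : RewritesTo P R g E) : RewritesTo P noComputedRules g E := by
  have sim : ∀ {Φ}, Steps P R (.lit [] g) Φ →
      ∃ Ψ, Steps P noComputedRules (.lit [] g) Ψ ∧ Padded (failing R) Φ Ψ := by
    intro Φ hs
    induction hs with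
    | refl => exact ⟨_, .refl, .refl _⟩
    | tail _ hs ih =>
      obtain ⟨Ψ, h1, hp⟩ := ih
      obtain ⟨Ψ', h2, hp'⟩ := hp.step hfail hs
      exact ⟨Ψ', h1.trans h2, hp'⟩
  obtain ⟨Ψ, hs, hp⟩ := sim h
  refine hs.trans (hp.steps_of_avoidsContexts hfail hE fun E' hs' _ C hC => ?_)
  exact RewritesTo.disjoint_failing hR (hs.trans hs') hC

/-! ### Series of recycling systems -/

theorem IsRecyclingSystem.isComputedRule {i : ℕ} (h : IsRecyclingSystem P i R) {p : Literal α}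
    {E : Goal α} (hE : R p = some E) : ∃ R', IsComputedRule P R' p E := by
  induction h with
  | zero => cases hE
  | @succ i R Δ _ hΔ ih =>
    rw [replaceRules] at hE
    cases hp : Δ p with
    | none => rw [hp] at hE; exact ih hE
    | some E' =>
      rw [hp] at hE
      cases hE
      exact ⟨R, hΔ p _ hp⟩

/-- A computed rule other than `p → F` persists: recycling it for `p` again does not lead to `F`,
because its contexts are consistent and contain `p`. -/
theorem IsComputedRule.eq_fls {R' : ComputedRules α} {p : Literal α} {E : Goal α}
    (h : IsComputedRule P R' p E) (hR : R p = some E) (hs : RewritesTo P R p .fls) : E = .fls := by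
  have hroot := Rooted.of_rewritesTo h.1
  rcases h.2.isAnswer with hE | hE
  · exact hE
  have hfil : (recycled [p] E).IsDisj := by
    refine isDisj_disj_tru _ ?_
    obtain ⟨C, hC⟩ := List.exists_mem_of_ne_nil _ hE.contexts_ne_nil
    obtain ⟨hc, hp⟩ := hroot.of_mem_contexts hC
    have hCp : C ∪ chainSet [p] = C :=
      Set.union_eq_left.2 fun x hx => List.mem_singleton.1 hx ▸ hp
    refine List.ne_nil_of_mem (a := C) (List.mem_filter.2 ⟨hC, ?_⟩)
    simp only [decide_eq_true_iff]
    rwa [hCp]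
  -- A chain of length one is not a loop, so only the recycling step applies to `p`.
  have hnl : ¬ FailingLoop [p] ∧ ¬ SucceedingLoop [p] := by
    have key : ∀ (x y : Literal α) M, ¬ (x :: M ++ [y]) <:+ [] ++ [p] :=
      fun x y M h => List.not_mem_nil (eq_of_suffix_concat h).2
    refine ⟨?_, fun h => List.not_mem_nil (SucceedingLoop.mem (S := []) h)⟩
    rintro ⟨S, hS, ⟨⟨x, M, rfl⟩, -⟩ | ⟨x, M, rfl⟩⟩
    · exact key _ _ _ hS
    · exact key _ _ _ hS
  rcases Relation.ReflTransGen.cases_head hs with h0 | ⟨Φ, hΦ, hs⟩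
  · cases h0
  cases hΦ with
  | program _ hn => rw [hR] at hn; cases hn
  | recycle _ hE' =>
    obtain rfl := Option.some.inj (hR.symm.trans hE')
    have : Goal.fls = recycled [p] E := IsAnswer.eq_of_steps (.inr hfil) hs
    rw [← this] at hfil
    exact hfil.elim
  | lr1 hl => exact (hnl.1 hl).elim
  | lr2 hl => exact (hnl.2 hl).elim

/-- If all computed rules are of the form `p → F`, then each such `p` rewrites to `F` in the
original system. -/
theorem IsRecyclingSystem.rewritesTo_fls {i : ℕ} (h : IsRecyclingSystem P i R)
    (hfail : ∀ p E, R p = some E → E = .fls) :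
    ∀ p ∈ failing R, RewritesTo P noComputedRules p .fls := by
  induction h with
  | zero => exact nofun
  | @succ i R Δ hR hΔ ih =>
    have hfailΔ : ∀ p E, Δ p = some E → E = .fls := fun p E hp =>
      hfail p E (by rw [replaceRules, hp]; rfl)
    have hfailR : ∀ p E, R p = some E → E = .fls := by
      intro p E hp
      cases hd : Δ p with
      | none => exact hfail p E (by rw [replaceRules, hd]; exact hp)
      | some E' =>
        obtain rfl := hfailΔ p E' hd
        obtain ⟨R', hc⟩ := hR.isComputedRule hp
        exact hc.eq_fls hp (hΔ p _ hd).1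
    intro p hp
    change (Δ p).or (R p) = some .fls at hp
    cases hd : Δ p with
    | none =>
      rw [hd] at hp
      exact ih hfailR p hp
    | some E =>
      obtain rfl := hfailΔ p E hd
      exact (hΔ p _ hd).1.to_noComputedRules hfailR (ih hfailR) (.inl rfl)

end Recycling

theorem corollary1 {α : Type*} (P : Recycling.Program α) (i : ℕ) (R : Recycling.ComputedRules α)
    (hR : Recycling.IsRecyclingSystem P i R)
    (hfail : ∀ p E, R p = some E → E = Recycling.Goal.fls)
    (g : Recycling.Literal α) (E : Recycling.Goal α)
    (hE : Recycling.IsNormalForm P Recycling.noComputedRules E ∨ Recycling.IsNormalForm P R E) :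
    Recycling.RewritesTo P Recycling.noComputedRules g E ↔ Recycling.RewritesTo P R g E := by
  have hE' : E.IsAnswer := hE.elim (fun h => h.isAnswer) fun h => h.isAnswer
  have hX := hR.rewritesTo_fls hfail
  exact ⟨.of_noComputedRules hfail hX hE', .to_noComputedRules hfail hX hE'⟩
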